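/- For $n\ge 0$ consider the eigenvalues of the $n\times n$ Gaussian unitary ensemble, that is, real variables $\lambda_1,\dots,\lambda_n$ with joint probability density $$\frac1{N_n}\,e^{-\sum_{j=1}^n\lambda_j^2}\prod_{1\le j<k\le n}(\lambda_j-\lambda_k)^2,\qquad N_n=\int_{\mathbb R^n}e^{-\sum_{j=1}^n\lambda_j^2}\prod_{1\le j<k\le n}(\lambda_j-\lambda_k)^2\,d\lambda .$$ Let $p(k,n)$ be the probability that exactly $k$ of the $\lambda_j$ are positive, let $\langle n_+\rangle=\sum_{k=0}^n k\,p(k,n)$, and let $$\Delta_n=\sum_{k=0}^n\bigl(k-\langle n_+\rangle\bigr)^2p(k,n)$$ be the variance of the number of positive eigenvalues (so $\Delta_0=0$). Then the even and the odd terms of $(\Delta_n)$ satisfy the following second-order linear inhomogeneous difference equations. For all integers $m\ge 1$, $$\frac{2m+1}{2m-1}\Delta_{2m+2}-\left[1+\frac{(2m+2)(2m+1)}{(2m)(2m-1)}\right]\Delta_{2m}+\frac{2m}{2m-2}\Delta_{2m-2}=-\frac1{2\pi^2}\,\frac{\Gamma(m+\frac12)\,\Gamma(m-\frac12)}{\Gamma(m+1)^2},$$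 where for $m=1$ the undefined quotient $\Delta_{2m-2}/(2m-2)=\Delta_0/0$ in the third term is given the value $\tfrac14$ (that is, the third term is $\tfrac12$); and for all integers $m\ge 1$, $$\frac{2m+1}{2m+3}\Delta_{2m+3}-\left[1+\frac{(2m)(2m-1)}{(2m+2)(2m+1)}\right]\Delta_{2m+1}+\frac{2m}{2m+2}\Delta_{2m-1}=-\frac1{2\pi^2}\,\frac{\Gamma(m+\frac12)^2}{\Gamma(m+2)\,\Gamma(m+1)}.$$ -/

import Mathlib

open MeasureTheory

namespace GUE

/-- The unnormalised joint eigenvalue density `e^{-∑ xⱼ²} ∏_{j<k} (xⱼ - xₖ)²` of the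
`n × n` Gaussian unitary ensemble, with respect to Lebesgue measure on `ℝⁿ`. -/
noncomputable def weight (n : ℕ) (x : Fin n → ℝ) : ℝ :=
  Real.exp (-∑ j, x j ^ 2) * ∏ j, ∏ k ∈ Finset.Ioi j, (x j - x k) ^ 2

/-- The normalisation `Nₙ`, the integral of the unnormalised density over `ℝⁿ`. -/
noncomputable def normalization (n : ℕ) : ℝ :=
  ∫ x : Fin n → ℝ, weight n x

open Classical in
/-- The number of positive eigenvalues, for eigenvalues `x₁, …, xₙ`. -/
noncomputable def index (n : ℕ) (x : Fin n → ℝ) : ℕ :=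
  (Finset.univ.filter fun j => 0 < x j).card

/-- The probability `p(k, n)` that exactly `k` of the `n` eigenvalues are positive. -/
noncomputable def indexProb (k n : ℕ) : ℝ :=
  (∫ x in {x : Fin n → ℝ | index n x = k}, weight n x) / normalization n

/-- The average number of positive eigenvalues. -/
noncomputable def indexMean (n : ℕ) : ℝ :=
  ∑ k ∈ Finset.range (n + 1), (k : ℝ) * indexProb k n

/-- The variance `Δₙ` of the number of positive eigenvalues. -/
noncomputable def indexVariance (n : ℕ) : ℝ :=
  ∑ k ∈ Finset.range (n + 1), ((k : ℝ) - indexMean n) ^ 2 * indexProb k n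

end GUE

/-!
The eigenvalues form a determinantal process. Column operations replace the Vandermonde determinant
by a determinant of monic Hermite polynomials `hₖ`, and the Andréief identity
(`integrable_and_integral_det_mul_det`) gives `E[z^index] = det (1 + (z - 1)A)`, where `A`
consists of the half-line inner products `∫₀^∞ hⱼ hₖ e^{-x²}`, normalised
(`sum_pow_mul_indexProb`). Hence the variance of the index is `tr A - tr A²`
(`variance_eq_trace_sub_trace_sq`).

The entries of `A` are explicit. The diagonal ones are `1/2` by parity. Since
`2(j - k) hⱼ hₖ e^{-x²}` is the derivative of the Wronskian of `hⱼ` and `hₖ` times `e^{-x²}`, the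
others are determined by the values at `0`; they vanish for `j ≡ k mod 2`, and for `j = 2p`,
`k = 2q + 1` their squares, normalised, are `(2q + 1) w_p w_q / (2π (2q + 1 - 2p)²)` with the
Wallis ratios `w_p = (2p)! / (4ᵖ p!²)` (`offDiagonalSq_even_odd`). The variance is therefore `n / 4`
minus a finite double sum.

The double sum collapses to a single one: with `xₘ = wₘ ∑_{q < m} (2q + 1) w_q / (2(m - q) - 1)²`,
it equals `n xₘ / π` both for `n = 2m` and for `n = 2m + 1` (`sum_sum_eq_varianceDefect`), so that
`Δ₂ₘ / (2m) = Δ₂ₘ₊₁ / (2m + 1) = 1/4 - xₘ / π`. In particular the continued value of `Δ₀ / 0` is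
`1/4`, because `x₀ = 0`. First-order recurrences for the sums `∑_{q < m} w_q / (2(m - q) - 1)ˢ`
show that `(2m + 1)(2m + 2)(x_{m+1} - xₘ)` has the increments `wₘ²`
(`varianceDefect_recurrence`). Both difference equations are this recurrence, rescaled, with the
Wallis ratios written through the Gamma function.
-/

namespace GUE

/-! ### Sums over Wallis ratios -/

/-- The Wallis ratios `wₘ = (2m)! / (4ᵐ m!²)`, the Taylor coefficients of `(1 - x)^(-1/2)`,
defined by their recurrence. -/
noncomputable def wallisRatio : ℕ → ℝ
  | 0 => 1
  | m + 1 => (2 * (m : ℝ) + 1) / (2 * (m : ℝ) + 2) * wallisRatio m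

/-- The sum `∑_{q < m} w_q / (2(m - q) - 1)ˢ`, the coefficient of `x^(m-1)` in the product of
`(1 - x)^(-1/2)` and `∑ xᵏ / (2k + 1)ˢ`. -/
noncomputable def wallisSum (s m : ℕ) : ℝ :=
  ∑ q ∈ Finset.range m, wallisRatio q / (2 * ((m : ℝ) - q) - 1) ^ s

/-- The sum `∑_{q < m} (2q + 1) w_q / (2(m - q) - 1)ˢ`. -/
noncomputable def oddWallisSum (s m : ℕ) : ℝ :=
  ∑ q ∈ Finset.range m, (2 * (q : ℝ) + 1) * wallisRatio q / (2 * ((m : ℝ) - q) - 1) ^ s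

lemma two_mul_sub_sub_one_ne_zero {q m : ℕ} (h : q < m) : 2 * ((m : ℝ) - q) - 1 ≠ 0 := by
  have : (q : ℝ) + 1 ≤ m := by exact_mod_cast h
  have : 0 < 2 * ((m : ℝ) - q) - 1 := by linarith
  exact this.ne'

lemma wallisRatio_succ_mul (m : ℕ) :
    (2 * (m : ℝ) + 2) * wallisRatio (m + 1) = (2 * (m : ℝ) + 1) * wallisRatio m := by
  have : 2 * (m : ℝ) + 2 ≠ 0 := by positivity
  rw [wallisRatio]
  field_simp

lemma Gamma_add_half_eq (m : ℕ) :
    Real.Gamma ((m : ℝ) + 1 / 2) = √Real.pi * (m.factorial * wallisRatio m) := by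
  induction m with
  | zero => simp [wallisRatio, -one_div, Real.Gamma_one_half_eq]
  | succ m ih =>
    have h : ((m + 1 : ℕ) : ℝ) + 1 / 2 = ((m : ℝ) + 1 / 2) + 1 := by push_cast; ring
    have h2 := wallisRatio_succ_mul m
    rw [h, Real.Gamma_add_one (by positivity), ih, Nat.factorial_succ]
    push_cast
    linear_combination (-(√Real.pi * m.factorial / 2)) * h2

/-- Splitting `2m = (2(m - q) - 1) + (2q + 1)` in each term. -/
lemma two_mul_mul_wallisSum (s m : ℕ) :
    2 * (m : ℝ) * wallisSum (s + 1) m = wallisSum s m + oddWallisSum (s + 1) m := by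
  simp only [wallisSum, oddWallisSum, Finset.mul_sum, ← Finset.sum_add_distrib]
  refine Finset.sum_congr rfl fun q hq => ?_
  have := two_mul_sub_sub_one_ne_zero (Finset.mem_range.1 hq)
  field_simp
  ring

/-- Splitting `2m + 1 = (2(m + 1 - q) - 1) + 2q` in each term; the recurrence of the Wallis ratios
turns `2q w_q` into `(2q - 1) w_{q-1}`, which shifts the second sum. -/
lemma two_mul_add_one_mul_wallisSum_succ (s m : ℕ) :
    (2 * (m : ℝ) + 1) * wallisSum (s + 1) (m + 1)
      = wallisSum s (m + 1) + oddWallisSum (s + 1) m := by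
  have h1 : (2 * (m : ℝ) + 1) * wallisSum (s + 1) (m + 1) = wallisSum s (m + 1)
      + ∑ q ∈ Finset.range (m + 1),
        2 * (q : ℝ) * wallisRatio q / (2 * (((m + 1 : ℕ) : ℝ) - q) - 1) ^ (s + 1) := by
    simp only [wallisSum, Finset.mul_sum, ← Finset.sum_add_distrib]
    refine Finset.sum_congr rfl fun q hq => ?_
    have := two_mul_sub_sub_one_ne_zero (Finset.mem_range.1 hq)
    field_simp
    push_cast
    ring
  rw [h1, Finset.sum_range_succ']
  simp only [oddWallisSum, CharP.cast_eq_zero, mul_zero, zero_mul, zero_div, add_zero]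
  congr 1
  refine Finset.sum_congr rfl fun q _ => ?_
  rw [← wallisRatio_succ_mul]
  push_cast
  congr 2 <;> ring

lemma wallisSum_zero_succ (m : ℕ) :
    wallisSum 0 (m + 1) = wallisSum 0 m + wallisRatio m := by
  simp [wallisSum, Finset.sum_range_succ]

/-- The quantity `xₘ = wₘ ∑_{q < m} (2q + 1) w_q / (2(m - q) - 1)²`, to which the index variance
reduces. -/
noncomputable def varianceDefect (m : ℕ) : ℝ :=
  wallisRatio m * oddWallisSum 2 m

lemma varianceDefect_zero : varianceDefect 0 = 0 := by
  simp [varianceDefect, oddWallisSum]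

lemma varianceDefect_succ (m : ℕ) :
    (2 * (m : ℝ) + 2) * varianceDefect (m + 1) = (2 * (m : ℝ) + 1) * varianceDefect m
      + (2 * (m : ℝ) + 1) * wallisRatio m * wallisSum 2 (m + 1) := by
  have h1 := two_mul_mul_wallisSum 1 (m + 1)
  have h2 := two_mul_add_one_mul_wallisSum_succ 1 m
  have h3 := wallisRatio_succ_mul m
  push_cast at h1
  simp only [varianceDefect]
  linear_combination (oddWallisSum 2 (m + 1)) * h3 - (2 * (m : ℝ) + 1) * wallisRatio m * h1
    + (2 * (m : ℝ) + 1) * wallisRatio m * h2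

/-- The first difference of `xₘ`. -/
lemma varianceDefect_succ_sub (m : ℕ) :
    (2 * (m : ℝ) + 2) * (varianceDefect (m + 1) - varianceDefect m)
      = wallisRatio m * wallisSum 1 (m + 1) := by
  have h1 := varianceDefect_succ m
  have h2 := two_mul_add_one_mul_wallisSum_succ 1 m
  simp only [varianceDefect] at *
  linear_combination h1 + wallisRatio m * h2

/-- The second-order recurrence of `xₘ`, the common source of both difference equations. -/
lemma varianceDefect_recurrence (m : ℕ) :
    (2 * (m : ℝ) + 3) * (2 * (m : ℝ) + 4) * (varianceDefect (m + 2) - varianceDefect (m + 1))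
      - (2 * (m : ℝ) + 2) * (2 * (m : ℝ) + 1) * (varianceDefect (m + 1) - varianceDefect m)
      = wallisRatio (m + 1) ^ 2 := by
  have h1 := varianceDefect_succ_sub (m + 1)
  have h2 := varianceDefect_succ_sub m
  have h3 := two_mul_add_one_mul_wallisSum_succ 0 (m + 1)
  have h4 := two_mul_mul_wallisSum 0 (m + 1)
  have h5 := wallisSum_zero_succ (m + 1)
  have h6 := wallisRatio_succ_mul m
  push_cast at *
  linear_combination (2 * (m : ℝ) + 3) * h1 - (2 * (m : ℝ) + 1) * h2
    + wallisRatio (m + 1) * (h3 - h4 + h5) + wallisSum 1 (m + 1) * h6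

lemma sum_range_two_mul (f : ℕ → ℝ) (m : ℕ) :
    ∑ j ∈ Finset.range (2 * m), f j
      = ∑ p ∈ Finset.range m, f (2 * p) + ∑ p ∈ Finset.range m, f (2 * p + 1) := by
  induction m with
  | zero => simp
  | succ m ih =>
    rw [show 2 * (m + 1) = 2 * m + 1 + 1 by ring, Finset.sum_range_succ, Finset.sum_range_succ, ih,
      Finset.sum_range_succ, Finset.sum_range_succ]
    ring

/-- A symmetric double sum over `range (n + 1)` with vanishing diagonal, split off its last row
and column. -/
lemma sum_sum_range_succ {T : ℕ → ℕ → ℝ} (hsymm : ∀ j k, T j k = T k j) (hdiag : ∀ j, T j j = 0)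
    (n : ℕ) :
    ∑ j ∈ Finset.range (n + 1), ∑ k ∈ Finset.range (n + 1), T j k
      = ∑ j ∈ Finset.range n, ∑ k ∈ Finset.range n, T j k + 2 * ∑ j ∈ Finset.range n, T j n := by
  simp only [Finset.sum_range_succ, Finset.sum_add_distrib, hdiag, hsymm n]
  ring

/-- The closed form of the double sum of the squared off-diagonal entries, proved for the even and
the odd sizes together by adding one row and column at a time. -/
lemma sum_sum_eq_varianceDefect {T : ℕ → ℕ → ℝ} (hsymm : ∀ j k, T j k = T k j)
    (heven : ∀ p q, T (2 * p) (2 * q) = 0) (hodd : ∀ p q, T (2 * p + 1) (2 * q + 1) = 0)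
    (hmix : ∀ p q, T (2 * p) (2 * q + 1) = (2 * (q : ℝ) + 1) * wallisRatio p * wallisRatio q
      / (2 * Real.pi * (2 * (q : ℝ) + 1 - 2 * p) ^ 2)) (m : ℕ) :
    ∑ j ∈ Finset.range (2 * m), ∑ k ∈ Finset.range (2 * m), T j k
        = 2 * m * (varianceDefect m / Real.pi) ∧
      ∑ j ∈ Finset.range (2 * m + 1), ∑ k ∈ Finset.range (2 * m + 1), T j k
        = (2 * m + 1) * (varianceDefect m / Real.pi) := by
  have hdiag : ∀ j, T j j = 0 := fun j => by
    obtain ⟨p, rfl | rfl⟩ := Nat.even_or_odd' j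
    exacts [heven p p, hodd p p]
  have hpi : Real.pi ≠ 0 := Real.pi_ne_zero
  have hcol (m : ℕ) : 2 * ∑ j ∈ Finset.range (2 * m), T j (2 * m)
      = varianceDefect m / Real.pi := by
    rw [sum_range_two_mul]
    simp only [heven, Finset.sum_const_zero, zero_add, varianceDefect, oddWallisSum,
      Finset.mul_sum, Finset.sum_div]
    refine Finset.sum_congr rfl fun q hq => ?_
    have h := two_mul_sub_sub_one_ne_zero (Finset.mem_range.1 hq)
    rw [hsymm, hmix, show (2 * (q : ℝ) + 1 - 2 * m) ^ 2 = (2 * ((m : ℝ) - q) - 1) ^ 2 by ring]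
    field_simp
  have hcol' (m : ℕ) : 2 * ∑ j ∈ Finset.range (2 * m + 1), T j (2 * m + 1)
      = (2 * (m : ℝ) + 1) * wallisRatio m * wallisSum 2 (m + 1) / Real.pi := by
    have : ∑ j ∈ Finset.range (2 * m + 1), T j (2 * m + 1)
        = ∑ j ∈ Finset.range (2 * (m + 1)), T j (2 * m + 1) := by
      rw [show 2 * (m + 1) = 2 * m + 1 + 1 by ring, Finset.sum_range_succ _ (2 * m + 1), hdiag,
        add_zero]
    rw [this, sum_range_two_mul]
    simp only [hodd, Finset.sum_const_zero, add_zero, wallisSum, Finset.mul_sum, Finset.sum_div]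
    refine Finset.sum_congr rfl fun q hq => ?_
    have h := two_mul_sub_sub_one_ne_zero (Finset.mem_range.1 hq)
    have h2 : 2 * (m : ℝ) + 1 - 2 * q = 2 * (((m + 1 : ℕ) : ℝ) - q) - 1 := by push_cast; ring
    rw [hmix, h2]
    field_simp
  have step (m : ℕ) (h : ∑ j ∈ Finset.range (2 * m), ∑ k ∈ Finset.range (2 * m), T j k
        = 2 * m * (varianceDefect m / Real.pi)) :
      ∑ j ∈ Finset.range (2 * m + 1), ∑ k ∈ Finset.range (2 * m + 1), T j k
        = (2 * m + 1) * (varianceDefect m / Real.pi) := by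
    rw [sum_sum_range_succ hsymm hdiag, h, hcol]
    ring
  induction m with
  | zero => exact ⟨by simp, step 0 (by simp)⟩
  | succ m ih =>
    refine (fun h => ⟨h, step _ h⟩) ?_
    rw [show 2 * (m + 1) = 2 * m + 1 + 1 by ring, sum_sum_range_succ hsymm hdiag, ih.2, hcol']
    have := varianceDefect_succ m
    push_cast
    linear_combination (-1 / Real.pi) * this

/-! ### Mean and variance from a determinantal generating function -/

open Polynomial in
/-- The second elementary symmetric function of the eigenvalues in terms of traces. It is read off
from the coefficient of `X²` in `det (1 + XM) det (1 - XM) = det (1 - X²M²)`, which needs only the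
first-order expansion of a determinant. -/
lemma two_mul_coeff_two_det_one_add_X_smul {n : ℕ} (M : Matrix (Fin n) (Fin n) ℝ) :
    2 * (Matrix.det (1 + (X : ℝ[X]) • M.map C)).coeff 2 = M.trace ^ 2 - (M * M).trace := by
  set p := Matrix.det (1 + (X : ℝ[X]) • M.map C) with hp
  have hmap (N : Matrix (Fin n) (Fin n) ℝ) (r : ℝ[X]) :
      (Matrix.det (1 + (X : ℝ[X]) • N.map C)).comp r = Matrix.det (1 + r • N.map C) := by
    have := RingHom.map_det (compRingHom r) (1 + (X : ℝ[X]) • N.map C)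
    rw [coe_compRingHom_apply] at this
    rw [this]
    congr 1
    ext i j : 2
    simp only [RingHom.mapMatrix_apply, Matrix.map_apply, Matrix.add_apply, Matrix.smul_apply,
      smul_eq_mul, Matrix.one_apply, coe_compRingHom_apply, add_comp, mul_comp, X_comp, C_comp]
    split_ifs <;> simp
  have hmul : p * p.comp (C (-1) * X) = (Matrix.det (1 + (X : ℝ[X]) • (-(M * M)).map C)).comp (X ^ 2) := by
    rw [hmap, hmap, hp, ← Matrix.det_mul, show (C (-1) * X : ℝ[X]) = -X by simp]
    congr 1
    have hsq : (-(M * M)).map (C : ℝ → ℝ[X]) = -(M.map C * M.map C) := by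
      ext i j : 2
      simp [Matrix.mul_apply]
    rw [hsq]
    simp only [mul_add, add_mul, one_mul, mul_one, neg_smul, Matrix.mul_neg, Matrix.smul_mul,
      Matrix.mul_smul, smul_neg, smul_smul, pow_two]
    abel
  have h0 : p.coeff 0 = 1 := by
    rw [coeff_zero_eq_eval_zero, hp, eval_det_add_X_smul]
    simp
  have h1 : p.coeff 1 = M.trace := Matrix.coeff_det_one_add_X_smul_one M
  have h2 := congrArg (fun q : ℝ[X] => q.coeff 2) hmul
  rw [← expand_eq_comp_X_pow] at h2
  simp only [coeff_mul, Finset.Nat.sum_antidiagonal_eq_sum_range_succ_mk, Finset.sum_range_succ,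
    Finset.sum_range_zero, comp_C_mul_X_coeff] at h2
  rw [show 2 = 1 * 2 from rfl, coeff_expand_mul (by norm_num),
    Matrix.coeff_det_one_add_X_smul_one (-(M * M)), Matrix.trace_neg] at h2
  simp [h0, h1] at h2
  linarith

open Polynomial in
/-- If `∑ pₖ zᵏ = det (1 + (z - 1)A)`, then the weights `pₖ` have variance `tr A - tr A²`. -/
lemma variance_eq_trace_sub_trace_sq {n : ℕ} (A : Matrix (Fin n) (Fin n) ℝ) (P : ℕ → ℝ) (N : ℕ)
    (h : ∀ z : ℝ, ∑ k ∈ Finset.range N, z ^ k * P k = (1 + (z - 1) • A).det) :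
    ∑ k ∈ Finset.range N, ((k : ℝ) - ∑ l ∈ Finset.range N, (l : ℝ) * P l) ^ 2 * P k
      = A.trace - (A * A).trace := by
  have hpoly : ∑ k ∈ Finset.range N, C (P k) * (X + 1) ^ k
      = Matrix.det (1 + (X : ℝ[X]) • A.map C) := by
    refine Polynomial.funext fun t => ?_
    have := h (t + 1)
    rw [add_sub_cancel_right] at this
    rw [eval_finsetSum, Matrix.det_one_add_X_smul]
    rw [Matrix.det_one_add_smul] at this
    simp only [eval_mul, eval_C, eval_pow, eval_add, eval_X, eval_one, eval_smul, smul_eq_mul]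
    rw [← this]
    exact Finset.sum_congr rfl fun k _ => mul_comm _ _
  have hcoeff (i : ℕ) : ∑ k ∈ Finset.range N, P k * (k.choose i : ℝ)
      = (Matrix.det (1 + (X : ℝ[X]) • A.map C)).coeff i := by
    rw [← hpoly, finsetSum_coeff]
    simp [coeff_X_add_one_pow]
  have h0 := hcoeff 0
  have h1 := hcoeff 1
  have h2 := hcoeff 2
  rw [coeff_zero_eq_eval_zero, eval_det_add_X_smul] at h0
  rw [Matrix.coeff_det_one_add_X_smul_one] at h1
  have h3 := two_mul_coeff_two_det_one_add_X_smul A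
  rw [← h2] at h3
  simp only [Nat.choose_zero_right, Nat.cast_one, mul_one, Nat.choose_one_right, eval_one,
    Matrix.det_one, Nat.cast_choose_two] at h0 h1 h3
  have hm : ∑ l ∈ Finset.range N, (l : ℝ) * P l = A.trace := by
    rw [← h1]
    exact Finset.sum_congr rfl fun k _ => mul_comm _ _
  rw [hm]
  have hexp : ∑ k ∈ Finset.range N, ((k : ℝ) - A.trace) ^ 2 * P k
      = 2 * ∑ k ∈ Finset.range N, P k * ((k : ℝ) * (k - 1) / 2)
        + (1 - 2 * A.trace) * ∑ k ∈ Finset.range N, P k * (k : ℝ)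
        + A.trace ^ 2 * ∑ k ∈ Finset.range N, P k := by
    simp only [Finset.mul_sum, ← Finset.sum_add_distrib]
    exact Finset.sum_congr rfl fun k _ => by ring
  rw [hexp, h3, h1, h0]
  simp
  ring

/-! ### The Andréief identity -/

/-- The Andréief identity: expanding both determinants, the integral factorises over the variables,
and for each fixed permutation in the second one the sum over the first is a determinant with
permuted columns. -/
lemma integrable_and_integral_det_mul_det {n : ℕ} (f g : Fin n → ℝ → ℝ)
    (hfg : ∀ j k, Integrable fun x => f j x * g k x) :
    Integrable (fun x : Fin n → ℝ => (Matrix.of fun j i => f j (x i)).det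
        * (Matrix.of fun j i => g j (x i)).det) ∧
      ∫ x : Fin n → ℝ, (Matrix.of fun j i => f j (x i)).det * (Matrix.of fun j i => g j (x i)).det
        = n.factorial * (Matrix.of fun j k => ∫ x, f j x * g k x).det := by
  have hterm (σ τ : Equiv.Perm (Fin n)) : Integrable fun x : Fin n → ℝ =>
      ((Equiv.Perm.sign σ : ℤ) : ℝ) * ((Equiv.Perm.sign τ : ℤ) : ℝ)
        * ∏ i, f (σ i) (x i) * g (τ i) (x i) :=
    (Integrable.fintype_prod (f := fun i y => f (σ i) y * g (τ i) y)
      fun i => hfg _ _).const_mul _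
  have hexp : (fun x : Fin n → ℝ => (Matrix.of fun j i => f j (x i)).det
      * (Matrix.of fun j i => g j (x i)).det) = fun x => ∑ τ : Equiv.Perm (Fin n),
        ∑ σ : Equiv.Perm (Fin n), ((Equiv.Perm.sign σ : ℤ) : ℝ) * ((Equiv.Perm.sign τ : ℤ) : ℝ)
        * ∏ i, f (σ i) (x i) * g (τ i) (x i) := by
    funext x
    rw [Matrix.det_apply', Matrix.det_apply', Finset.sum_mul_sum, Finset.sum_comm]
    refine Finset.sum_congr rfl fun τ _ => Finset.sum_congr rfl fun σ _ => ?_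
    simp only [Matrix.of_apply, Finset.prod_mul_distrib]
    ring
  rw [hexp]
  refine ⟨integrable_finsetSum _ fun τ _ => integrable_finsetSum _ fun σ _ => hterm σ τ, ?_⟩
  rw [integral_finsetSum _ fun τ _ => integrable_finsetSum _ fun σ _ => hterm σ τ]
  set G : Matrix (Fin n) (Fin n) ℝ := Matrix.of fun j k => ∫ x, f j x * g k x with hG
  have hτ (τ : Equiv.Perm (Fin n)) : ∫ x : Fin n → ℝ, ∑ σ : Equiv.Perm (Fin n),
      ((Equiv.Perm.sign σ : ℤ) : ℝ) * ((Equiv.Perm.sign τ : ℤ) : ℝ)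
        * ∏ i, f (σ i) (x i) * g (τ i) (x i) = G.det := by
    rw [integral_finsetSum _ fun σ _ => hterm σ τ]
    have h1 := Matrix.det_permute' τ G
    rw [Matrix.det_apply'] at h1
    have h2 : ((Equiv.Perm.sign τ : ℤ) : ℝ) * ((Equiv.Perm.sign τ : ℤ) : ℝ) = 1 := by
      rw [← Int.cast_mul, ← Units.val_mul, Int.units_mul_self]
      simp
    calc _ = ((Equiv.Perm.sign τ : ℤ) : ℝ) * ∑ σ : Equiv.Perm (Fin n),
          ((Equiv.Perm.sign σ : ℤ) : ℝ) * ∏ i, G.submatrix id τ (σ i) i := by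
          rw [Finset.mul_sum]
          refine Finset.sum_congr rfl fun σ _ => ?_
          rw [integral_const_mul, integral_fintype_prod_volume_eq_prod
            (f := fun i y => f (σ i) y * g (τ i) y)]
          simp only [hG, Matrix.submatrix_apply, Matrix.of_apply, id]
          ring
      _ = G.det := by rw [h1, ← mul_assoc, h2, one_mul]
  simp [hτ, Fintype.card_perm]

/-! ### Monic Hermite polynomials -/

open Polynomial

/-- The monic Hermite polynomials orthogonal for the weight `e^{-x²}`, defined by the Rodrigues
recurrence `h_{k+1} = X hₖ - hₖ' / 2`. -/
noncomputable def monicHermite : ℕ → ℝ[X]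
  | 0 => 1
  | k + 1 => X * monicHermite k - C (1 / 2) * derivative (monicHermite k)

lemma derivative_monicHermite_succ (k : ℕ) :
    derivative (monicHermite (k + 1)) = C ((k : ℝ) + 1) * monicHermite k := by
  induction k with
  | zero => simp [monicHermite]
  | succ k ih =>
    have h : derivative (monicHermite (k + 1 + 1)) = monicHermite (k + 1)
        + X * derivative (monicHermite (k + 1))
        - C (1 / 2) * derivative (derivative (monicHermite (k + 1))) := by
      rw [monicHermite]
      simp only [derivative_sub, derivative_mul, derivative_X, derivative_C]
      ring
    rw [h, ih, derivative_mul, derivative_C]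
    simp only [monicHermite, Nat.cast_add, Nat.cast_one, C_add, C_1]
    ring

/-- The Hermite differential equation. -/
lemma derivative_derivative_monicHermite (k : ℕ) :
    derivative (derivative (monicHermite k)) - 2 * X * derivative (monicHermite k)
      = -(2 * C (k : ℝ) * monicHermite k) := by
  have h1 := derivative_monicHermite_succ k
  have h2 : (2 : ℝ[X]) * C (1 / 2) = 1 := by
    rw [← C_ofNat, ← C_mul]
    norm_num
  rw [monicHermite] at h1
  simp only [derivative_sub, derivative_mul, derivative_X, derivative_C, C_add, C_1] at h1
  linear_combination (-2) * h1 - derivative (derivative (monicHermite k)) * h2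

lemma natDegree_monicHermite_and_monic (k : ℕ) :
    (monicHermite k).natDegree = k ∧ (monicHermite k).Monic := by
  induction k with
  | zero => simp [monicHermite]
  | succ k ih =>
    have hm : (X * monicHermite k).Monic := monic_X.mul ih.2
    have hd : (X * monicHermite k).degree = ((k + 1 : ℕ) : WithBot ℕ) := by
      rw [degree_mul, degree_X, degree_eq_natDegree ih.2.ne_zero, ih.1]
      push_cast
      ring
    have hlt : (C (1 / 2) * derivative (monicHermite k)).degree < (X * monicHermite k).degree := by
      rw [hd, degree_C_mul (by norm_num)]
      refine (degree_derivative_le).trans_lt ?_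
      rw [degree_eq_natDegree ih.2.ne_zero, ih.1]
      exact_mod_cast k.lt_succ_self
    refine ⟨?_, hm.sub_of_left hlt⟩
    rw [monicHermite]
    exact natDegree_eq_of_degree_eq_some ((degree_sub_eq_left_of_degree_lt hlt).trans hd)

lemma eval_zero_monicHermite_add_two (k : ℕ) :
    (monicHermite (k + 2)).eval 0 = -(((k : ℝ) + 1) / 2) * (monicHermite k).eval 0 := by
  rw [monicHermite, derivative_monicHermite_succ]
  simp
  ring

lemma eval_zero_monicHermite_odd (q : ℕ) : (monicHermite (2 * q + 1)).eval 0 = 0 := by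
  induction q with
  | zero => simp [monicHermite]
  | succ q ih =>
    rw [show 2 * (q + 1) + 1 = 2 * q + 1 + 2 by ring, eval_zero_monicHermite_add_two, ih, mul_zero]

lemma eval_zero_derivative_monicHermite_even (p : ℕ) :
    (derivative (monicHermite (2 * p))).eval 0 = 0 := by
  cases p with
  | zero => simp [monicHermite]
  | succ p =>
    rw [show 2 * (p + 1) = 2 * p + 1 + 1 by ring, derivative_monicHermite_succ, eval_mul,
      eval_zero_monicHermite_odd, mul_zero]

lemma eval_neg_monicHermite (k : ℕ) (x : ℝ) :
    (monicHermite k).eval (-x) = (-1) ^ k * (monicHermite k).eval x := by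
  have h : ∀ k, (monicHermite k).comp (-X) = C ((-1) ^ k) * monicHermite k := fun k => by
    induction k with
    | zero => simp [monicHermite]
    | succ k ih =>
      have h1 := congrArg derivative ih
      rw [derivative_comp, derivative_mul, derivative_C] at h1
      simp only [derivative_neg, derivative_X, zero_mul, zero_add] at h1
      rw [monicHermite, sub_comp, mul_comp, mul_comp, C_comp, X_comp, ih, pow_succ, C_mul]
      have h2 : (C (-1) : ℝ[X]) = -1 := by simp
      rw [h2]
      linear_combination C (1 / 2) * h1
  simpa using congrArg (eval x) (h k)

/-- The squared norm `√π k! / 2ᵏ` of `monicHermite k` for the weight `e^{-x²}`. -/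
noncomputable def hermiteNormSq (k : ℕ) : ℝ :=
  √Real.pi * k.factorial / 2 ^ k

lemma hermiteNormSq_pos (k : ℕ) : 0 < hermiteNormSq k := by
  have := Real.pi_pos
  unfold hermiteNormSq
  positivity

lemma hermiteNormSq_succ (k : ℕ) :
    hermiteNormSq (k + 1) = ((k : ℝ) + 1) / 2 * hermiteNormSq k := by
  rw [hermiteNormSq, hermiteNormSq, Nat.factorial_succ, pow_succ]
  push_cast
  field_simp

lemma sq_eval_zero_monicHermite (p : ℕ) :
    √Real.pi * (monicHermite (2 * p)).eval 0 ^ 2 = wallisRatio p * hermiteNormSq (2 * p) := by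
  induction p with
  | zero => simp [monicHermite, wallisRatio, hermiteNormSq]
  | succ p ih =>
    have h := wallisRatio_succ_mul p
    rw [show 2 * (p + 1) = 2 * p + 1 + 1 by ring, eval_zero_monicHermite_add_two,
      hermiteNormSq_succ, hermiteNormSq_succ]
    push_cast
    linear_combination ((2 * (p : ℝ) + 1) / 2) ^ 2 * ih
      - (2 * (p : ℝ) + 1) / 4 * hermiteNormSq (2 * p) * h

/-! ### Integrals of Hermite polynomials over the line and the half-line -/

lemma integrable_eval_mul_exp_neg_sq (p : ℝ[X]) :
    Integrable fun x : ℝ => p.eval x * Real.exp (-x ^ 2) := by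
  induction p using Polynomial.induction_on' with
  | add p q hp hq => simpa only [eval_add, add_mul] using hp.fun_add hq
  | monomial n a =>
    have := (integrable_rpow_mul_exp_neg_mul_sq (b := 1) one_pos (s := n)
      (by linarith [n.cast_nonneg (α := ℝ)])).const_mul a
    simpa only [eval_monomial, mul_assoc, Real.rpow_natCast, neg_mul, one_mul] using this

lemma hasDerivAt_eval_mul_exp_neg_sq (p : ℝ[X]) (x : ℝ) :
    HasDerivAt (fun x : ℝ => p.eval x * Real.exp (-x ^ 2))
      ((derivative p - 2 * X * p).eval x * Real.exp (-x ^ 2)) x := by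
  have h1 : HasDerivAt (fun x : ℝ => -x ^ 2) (-(2 * x)) x := by
    simpa using (hasDerivAt_pow 2 x).fun_neg
  refine ((p.hasDerivAt x).fun_mul h1.exp).congr_deriv ?_
  simp only [eval_sub, eval_mul, eval_X, eval_ofNat]
  ring

lemma integral_derivative_sub_mul_exp_neg_sq (p : ℝ[X]) :
    ∫ x : ℝ, (derivative p - 2 * X * p).eval x * Real.exp (-x ^ 2) = 0 :=
  integral_eq_zero_of_hasDerivAt_of_integrable (hasDerivAt_eval_mul_exp_neg_sq p)
    (integrable_eval_mul_exp_neg_sq _) (integrable_eval_mul_exp_neg_sq p)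

lemma integral_Ioi_derivative_sub_mul_exp_neg_sq (p : ℝ[X]) :
    ∫ x in Set.Ioi (0 : ℝ), (derivative p - 2 * X * p).eval x * Real.exp (-x ^ 2) = -p.eval 0 := by
  rw [integral_Ioi_of_hasDerivAt_of_tendsto' (fun x _ => hasDerivAt_eval_mul_exp_neg_sq p x)
    (integrable_eval_mul_exp_neg_sq _).integrableOn
    (tendsto_zero_of_hasDerivAt_of_integrableOn_Ioi (a := 0)
      (fun x _ => hasDerivAt_eval_mul_exp_neg_sq p x)
      (integrable_eval_mul_exp_neg_sq _).integrableOn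
      (integrable_eval_mul_exp_neg_sq _).integrableOn)]
  simp

/-- By the Hermite differential equation, `hⱼ hₖ e^{-x²}` is up to the factor `2(j - k)` the
derivative of the Wronskian of `hⱼ` and `hₖ` times `e^{-x²}`. -/
lemma derivative_wronskian_monicHermite (j k : ℕ) :
    derivative (monicHermite j * derivative (monicHermite k)
        - monicHermite k * derivative (monicHermite j))
      - 2 * X * (monicHermite j * derivative (monicHermite k)
        - monicHermite k * derivative (monicHermite j))
      = C (2 * ((j : ℝ) - k)) * (monicHermite j * monicHermite k) := by
  have h1 := derivative_derivative_monicHermite j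
  have h2 := derivative_derivative_monicHermite k
  simp only [derivative_sub, derivative_mul, C_mul, C_sub, C_ofNat]
  linear_combination monicHermite j * h2 - monicHermite k * h1

lemma integral_monicHermite_mul_of_ne {j k : ℕ} (h : j ≠ k) :
    ∫ x : ℝ, (monicHermite j * monicHermite k).eval x * Real.exp (-x ^ 2) = 0 := by
  have h1 := integral_derivative_sub_mul_exp_neg_sq (monicHermite j * derivative (monicHermite k)
    - monicHermite k * derivative (monicHermite j))
  rw [derivative_wronskian_monicHermite] at h1
  simp only [eval_mul, eval_C, mul_assoc (2 * ((j : ℝ) - k)), integral_const_mul] at h1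
  have h2 : (j : ℝ) - k ≠ 0 := sub_ne_zero.2 (by exact_mod_cast h)
  simpa [h2] using h1

lemma integral_monicHermite_sq (k : ℕ) :
    ∫ x : ℝ, (monicHermite k * monicHermite k).eval x * Real.exp (-x ^ 2) = hermiteNormSq k := by
  induction k with
  | zero =>
    have := integral_gaussian 1
    simpa [monicHermite, hermiteNormSq] using this
  | succ k ih =>
    -- integration by parts against `(hₖ e^{-x²})' = -2 h_{k+1} e^{-x²}`
    have h1 := integral_derivative_sub_mul_exp_neg_sq (monicHermite k * monicHermite (k + 1))
    have h2 : (2 : ℝ[X]) * C (1 / 2) = 1 := by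
      rw [← C_ofNat, ← C_mul]
      norm_num
    have h3 : derivative (monicHermite k * monicHermite (k + 1))
        - 2 * X * (monicHermite k * monicHermite (k + 1))
        = C ((k : ℝ) + 1) * (monicHermite k * monicHermite k)
          - C 2 * (monicHermite (k + 1) * monicHermite (k + 1)) := by
      have h4 : C 2 * monicHermite (k + 1)
          = 2 * X * monicHermite k - derivative (monicHermite k) := by
        rw [monicHermite, C_ofNat]
        linear_combination -derivative (monicHermite k) * h2
      rw [derivative_mul, derivative_monicHermite_succ]
      linear_combination monicHermite (k + 1) * h4
    rw [h3] at h1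
    simp only [eval_sub, eval_mul (p := C _), eval_C, sub_mul, mul_assoc] at h1
    rw [integral_sub ((integrable_eval_mul_exp_neg_sq _).const_mul _)
      ((integrable_eval_mul_exp_neg_sq _).const_mul _), integral_const_mul, integral_const_mul,
      ih] at h1
    rw [hermiteNormSq_succ]
    linarith

/-- The inner products of the Hermite polynomials over the positive half-line. -/
noncomputable def halfLineInner (j k : ℕ) : ℝ :=
  ∫ x in Set.Ioi (0 : ℝ), (monicHermite j * monicHermite k).eval x * Real.exp (-x ^ 2)

lemma halfLineInner_symm (j k : ℕ) : halfLineInner j k = halfLineInner k j := by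
  rw [halfLineInner, mul_comm (monicHermite j), halfLineInner]

lemma halfLineInner_self (k : ℕ) : halfLineInner k k = hermiteNormSq k / 2 := by
  have h := integral_comp_abs
    (f := fun x : ℝ => (monicHermite k * monicHermite k).eval x * Real.exp (-x ^ 2))
  have h2 : (fun x : ℝ => (monicHermite k * monicHermite k).eval |x| * Real.exp (-|x| ^ 2))
      = fun x => (monicHermite k * monicHermite k).eval x * Real.exp (-x ^ 2) := by
    funext x
    rcases abs_choice x with hx | hx <;> rw [hx]
    rw [eval_mul, eval_neg_monicHermite, eval_mul, neg_sq]
    have : ((-1 : ℝ) ^ k) * (-1) ^ k = 1 := by rw [← mul_pow]; simp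
    linear_combination (monicHermite k).eval x ^ 2 * Real.exp (-x ^ 2) * this
  rw [h2, integral_monicHermite_sq] at h
  rw [halfLineInner]
  linarith

lemma two_mul_sub_mul_halfLineInner (j k : ℕ) :
    2 * ((j : ℝ) - k) * halfLineInner j k
      = (monicHermite k).eval 0 * (derivative (monicHermite j)).eval 0
        - (monicHermite j).eval 0 * (derivative (monicHermite k)).eval 0 := by
  have h1 := integral_Ioi_derivative_sub_mul_exp_neg_sq
    (monicHermite j * derivative (monicHermite k) - monicHermite k * derivative (monicHermite j))
  rw [derivative_wronskian_monicHermite] at h1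
  simp only [eval_mul (p := C _), eval_C, mul_assoc (2 * ((j : ℝ) - k)), integral_const_mul] at h1
  rw [halfLineInner, h1]
  simp

/-- The squared off-diagonal entries of the matrix of the half-line inner products of the
normalised Hermite functions, with the diagonal set to zero. -/
noncomputable def offDiagonalSq (j k : ℕ) : ℝ :=
  if j = k then 0 else halfLineInner j k ^ 2 / (hermiteNormSq j * hermiteNormSq k)

lemma offDiagonalSq_symm (j k : ℕ) : offDiagonalSq j k = offDiagonalSq k j := by
  rw [offDiagonalSq, offDiagonalSq, halfLineInner_symm, mul_comm (hermiteNormSq j)]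
  simp only [eq_comm]

lemma offDiagonalSq_eq_zero {j k : ℕ} (h : (monicHermite k).eval 0
      * (derivative (monicHermite j)).eval 0 = (monicHermite j).eval 0
      * (derivative (monicHermite k)).eval 0) : offDiagonalSq j k = 0 := by
  unfold offDiagonalSq
  split_ifs with hjk
  · rfl
  · have h1 := two_mul_sub_mul_halfLineInner j k
    have h2 : (j : ℝ) - k ≠ 0 := sub_ne_zero.2 (by exact_mod_cast hjk)
    rw [h, sub_self] at h1
    have h3 : halfLineInner j k = 0 := by simpa [h2] using h1
    simp [h3]

lemma offDiagonalSq_even_odd (p q : ℕ) : offDiagonalSq (2 * p) (2 * q + 1)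
    = (2 * (q : ℝ) + 1) * wallisRatio p * wallisRatio q
      / (2 * Real.pi * (2 * (q : ℝ) + 1 - 2 * p) ^ 2) := by
  have h1 := two_mul_sub_mul_halfLineInner (2 * p) (2 * q + 1)
  rw [eval_zero_monicHermite_odd, derivative_monicHermite_succ, zero_mul, zero_sub, eval_mul,
    eval_C] at h1
  have hp := sq_eval_zero_monicHermite p
  have hq := sq_eval_zero_monicHermite q
  have hne : 2 * (q : ℝ) + 1 - 2 * p ≠ 0 := by
    have : (2 * (q : ℤ) + 1 - 2 * p) ≠ 0 := by omega
    exact_mod_cast this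
  have hpi := Real.pi_pos
  have hs := Real.sq_sqrt hpi.le
  have hgp := (hermiteNormSq_pos (2 * p)).ne'
  have hgq := (hermiteNormSq_pos (2 * q)).ne'
  push_cast at h1
  rw [offDiagonalSq, if_neg (by omega), hermiteNormSq_succ, div_eq_div_iff (by positivity)
    (by positivity)]
  push_cast
  -- both sides equal `(2q + 1)² h₂ₚ(0)² h₂q(0)² π / 2` by the Wronskian formula
  have hsq := congrArg (· ^ 2) h1
  linear_combination (Real.pi / 2) * hsq
    - ((2 * (q : ℝ) + 1) ^ 2 / 2) * (monicHermite (2 * p)).eval 0 ^ 2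
        * (monicHermite (2 * q)).eval 0 ^ 2 * hs
    + ((2 * (q : ℝ) + 1) ^ 2 / 2) * √Real.pi * (monicHermite (2 * q)).eval 0 ^ 2 * hp
    + ((2 * (q : ℝ) + 1) ^ 2 / 2) * wallisRatio p * hermiteNormSq (2 * p) * hq

lemma sum_sum_offDiagonalSq (m : ℕ) :
    ∑ j ∈ Finset.range (2 * m), ∑ k ∈ Finset.range (2 * m), offDiagonalSq j k
        = 2 * m * (varianceDefect m / Real.pi) ∧
      ∑ j ∈ Finset.range (2 * m + 1), ∑ k ∈ Finset.range (2 * m + 1), offDiagonalSq j k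
        = (2 * m + 1) * (varianceDefect m / Real.pi) :=
  sum_sum_eq_varianceDefect offDiagonalSq_symm
    (fun p q => offDiagonalSq_eq_zero (by simp only [eval_zero_derivative_monicHermite_even,
      mul_zero]))
    (fun p q => offDiagonalSq_eq_zero (by simp only [eval_zero_monicHermite_odd, zero_mul]))
    offDiagonalSq_even_odd m

/-! ### The generating function of the index -/

/-- The weight of a single variable, `e^{-x²}` on the negative and `z e^{-x²}` on the positive
half-line. -/
noncomputable def tiltedGaussian (z x : ℝ) : ℝ :=
  Real.exp (-x ^ 2) + (z - 1) * (Set.Ioi (0 : ℝ)).indicator (fun x => Real.exp (-x ^ 2)) x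

lemma integrable_and_integral_eval_mul_tiltedGaussian (p : ℝ[X]) (z : ℝ) :
    Integrable (fun x => p.eval x * tiltedGaussian z x) ∧
      ∫ x, p.eval x * tiltedGaussian z x = (∫ x, p.eval x * Real.exp (-x ^ 2))
        + (z - 1) * ∫ x in Set.Ioi (0 : ℝ), p.eval x * Real.exp (-x ^ 2) := by
  have h : (fun x => p.eval x * tiltedGaussian z x) = fun x => p.eval x * Real.exp (-x ^ 2)
      + (z - 1) * (Set.Ioi (0 : ℝ)).indicator (fun x => p.eval x * Real.exp (-x ^ 2)) x := by
    funext x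
    simp only [tiltedGaussian, Set.indicator_apply]
    split_ifs <;> ring
  have h1 := integrable_eval_mul_exp_neg_sq p
  have h2 := (h1.indicator (measurableSet_Ioi (a := (0 : ℝ)))).const_mul (z - 1)
  rw [h]
  refine ⟨h1.add h2, ?_⟩
  rw [integral_add h1 h2, integral_const_mul, integral_indicator measurableSet_Ioi]

lemma pow_index_mul_exp (n : ℕ) (z : ℝ) (x : Fin n → ℝ) :
    z ^ index n x * Real.exp (-∑ j, x j ^ 2) = ∏ j, tiltedGaussian z (x j) := by
  classical
  have h : z ^ index n x = ∏ j, if 0 < x j then z else 1 := by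
    rw [index, ← Finset.prod_const, Finset.prod_filter]
  rw [h, ← Finset.sum_neg_distrib, Real.exp_sum, ← Finset.prod_mul_distrib]
  refine Finset.prod_congr rfl fun j _ => ?_
  simp only [tiltedGaussian, Set.indicator_apply, Set.mem_Ioi]
  split_ifs <;> ring

/-- Column operations turn the Vandermonde determinant into one of monic Hermite polynomials. -/
lemma prod_sub_sq_eq_det_monicHermite_sq (n : ℕ) (x : Fin n → ℝ) :
    ∏ j, ∏ k ∈ Finset.Ioi j, (x j - x k) ^ 2
      = (Matrix.of fun j i : Fin n => (monicHermite j).eval (x i)).det ^ 2 := by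
  have h := Matrix.det_eval_matrixOfPolynomials_eq_det_vandermonde x
    (fun j : Fin n => monicHermite j) (fun j => (natDegree_monicHermite_and_monic j).1)
    (fun j => (natDegree_monicHermite_and_monic j).2)
  rw [← Matrix.det_transpose (Matrix.of fun i j : Fin n => _)] at h
  have h2 : (Matrix.of fun i j : Fin n => (monicHermite j).eval (x i)).transpose
      = Matrix.of fun j i : Fin n => (monicHermite j).eval (x i) := rfl
  rw [h2, Matrix.det_vandermonde] at h
  rw [← h, ← Finset.prod_pow]
  refine Finset.prod_congr rfl fun j _ => ?_
  rw [← Finset.prod_pow]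
  exact Finset.prod_congr rfl fun k _ => by ring

/-- The matrix of the half-line inner products of the Hermite polynomials, each row divided by
the squared norm: the compression of the indicator of the positive half-line to the span of the
first `n` Hermite functions. -/
noncomputable def halfLineMatrix (n : ℕ) : Matrix (Fin n) (Fin n) ℝ :=
  Matrix.of fun j k => halfLineInner j k / hermiteNormSq j

lemma integrable_and_integral_pow_index_mul_weight (n : ℕ) (z : ℝ) :
    Integrable (fun x => z ^ index n x * weight n x) ∧
      ∫ x, z ^ index n x * weight n x = n.factorial * (∏ j : Fin n, hermiteNormSq j)
        * (1 + (z - 1) • halfLineMatrix n).det := by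
  have hfg (j k : Fin n) : (fun x => tiltedGaussian z x * (monicHermite j).eval x
      * (monicHermite k).eval x)
      = fun x => (monicHermite j * monicHermite k).eval x * tiltedGaussian z x := by
    funext x
    rw [Polynomial.eval_mul]
    ring
  have h := integrable_and_integral_det_mul_det
    (fun j : Fin n => fun x => tiltedGaussian z x * (monicHermite j).eval x)
    (fun j : Fin n => fun x => (monicHermite j).eval x) fun j k => by
      rw [hfg]
      exact (integrable_and_integral_eval_mul_tiltedGaussian _ z).1
  have hint : (fun x : Fin n → ℝ => (Matrix.of fun j i : Fin n =>
        tiltedGaussian z (x i) * (monicHermite j).eval (x i)).det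
      * (Matrix.of fun j i : Fin n => (monicHermite j).eval (x i)).det)
      = fun x => z ^ index n x * weight n x := by
    funext x
    have hrow := Matrix.det_mul_row (fun i => tiltedGaussian z (x i))
      (Matrix.of fun j i : Fin n => (monicHermite j).eval (x i))
    simp only [Matrix.of_apply] at hrow
    rw [hrow, weight, ← mul_assoc, pow_index_mul_exp, prod_sub_sq_eq_det_monicHermite_sq]
    ring
  have hmat : (Matrix.of fun j k : Fin n => ∫ x, tiltedGaussian z x * (monicHermite j).eval x
      * (monicHermite k).eval x)
      = Matrix.diagonal (fun j : Fin n => hermiteNormSq j) * (1 + (z - 1) • halfLineMatrix n) := by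
    ext j k
    have hj := (hermiteNormSq_pos j).ne'
    simp only [Matrix.of_apply, hfg, Matrix.diagonal_mul, Matrix.add_apply, Matrix.smul_apply,
      halfLineMatrix, smul_eq_mul]
    rw [(integrable_and_integral_eval_mul_tiltedGaussian _ z).2, ← halfLineInner]
    by_cases hjk : j = k
    · subst hjk
      rw [integral_monicHermite_sq, Matrix.one_apply_eq]
      field_simp
    · rw [integral_monicHermite_mul_of_ne (fun hv => hjk (Fin.ext hv)), Matrix.one_apply_ne hjk]
      field_simp
      ring
  rw [hint, hmat, Matrix.det_mul, Matrix.det_diagonal, ← mul_assoc] at h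
  exact h

lemma measurable_index (n : ℕ) : Measurable (index n) := by
  classical
  have h : index n = fun x => ∑ j, if 0 < x j then 1 else 0 := by
    funext x
    rw [index, Finset.card_filter]
  rw [h]
  exact Finset.measurable_sum _ fun j _ =>
    Measurable.ite (measurableSet_lt measurable_const (measurable_pi_apply j))
      measurable_const measurable_const

lemma index_le (n : ℕ) (x : Fin n → ℝ) : index n x ≤ n := by
  simpa [index] using Finset.card_filter_le (Finset.univ : Finset (Fin n)) _

lemma integrable_weight (n : ℕ) : Integrable (weight n) := by
  simpa using (integrable_and_integral_pow_index_mul_weight n 1).1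

lemma normalization_eq (n : ℕ) :
    normalization n = n.factorial * ∏ j : Fin n, hermiteNormSq j := by
  simpa [normalization] using (integrable_and_integral_pow_index_mul_weight n 1).2

lemma normalization_ne_zero (n : ℕ) : normalization n ≠ 0 := by
  rw [normalization_eq]
  have : 0 < ∏ j : Fin n, hermiteNormSq j := Finset.prod_pos fun j _ => hermiteNormSq_pos j
  positivity

lemma sum_pow_mul_indexProb (n : ℕ) (z : ℝ) :
    ∑ k ∈ Finset.range (n + 1), z ^ k * indexProb k n = (1 + (z - 1) • halfLineMatrix n).det := by
  have hmeas (k : ℕ) : MeasurableSet {x : Fin n → ℝ | index n x = k} :=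
    measurable_index n (measurableSet_singleton k)
  have hsum : (fun x => z ^ index n x * weight n x) = fun x => ∑ k ∈ Finset.range (n + 1),
      z ^ k * {x : Fin n → ℝ | index n x = k}.indicator (weight n) x := by
    funext x
    simp [Set.indicator_apply, index_le]
  have h := (integrable_and_integral_pow_index_mul_weight n z).2
  rw [hsum, integral_finsetSum _ fun k _ =>
    ((integrable_weight n).indicator (hmeas k)).const_mul _, ← normalization_eq] at h
  simp only [integral_const_mul, integral_indicator (hmeas _)] at h
  rw [← mul_right_inj' (normalization_ne_zero n), ← h, Finset.mul_sum]
  refine Finset.sum_congr rfl fun k _ => ?_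
  have := normalization_ne_zero n
  rw [indexProb]
  field_simp

/-! ### The index variance -/

lemma indexVariance_eq (n : ℕ) : indexVariance n = (n : ℝ) / 4
    - ∑ j ∈ Finset.range n, ∑ k ∈ Finset.range n, offDiagonalSq j k := by
  have h := variance_eq_trace_sub_trace_sq (halfLineMatrix n) (fun k => indexProb k n) (n + 1)
    (sum_pow_mul_indexProb n)
  have hd (j : ℕ) : halfLineInner j j / hermiteNormSq j = 1 / 2 := by
    have := (hermiteNormSq_pos j).ne'
    rw [halfLineInner_self]
    field_simp
  have hsq (j k : Fin n) : halfLineMatrix n j k * halfLineMatrix n k j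
      = (if j = k then 1 / 4 else 0) + offDiagonalSq j k := by
    simp only [halfLineMatrix, Matrix.of_apply, offDiagonalSq, Fin.val_inj]
    split_ifs with hjk
    · rw [hjk, hd]
      norm_num
    · rw [halfLineInner_symm k j, div_mul_div_comm]
      ring
  rw [indexVariance, indexMean, h]
  simp only [Matrix.trace, Matrix.diag_apply, Matrix.mul_apply, hsq, Finset.sum_add_distrib]
  simp only [halfLineMatrix, Matrix.of_apply, hd, Finset.sum_range, Finset.sum_ite_eq,
    Finset.mem_univ, if_true, Finset.sum_const, Finset.card_univ, Fintype.card_fin, nsmul_eq_mul]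
  ring

lemma indexVariance_even (m : ℕ) :
    indexVariance (2 * m) = 2 * (m : ℝ) * (1 / 4 - varianceDefect m / Real.pi) := by
  rw [indexVariance_eq, (sum_sum_offDiagonalSq m).1]
  push_cast
  ring

lemma indexVariance_odd (m : ℕ) :
    indexVariance (2 * m + 1) = (2 * (m : ℝ) + 1) * (1 / 4 - varianceDefect m / Real.pi) := by
  rw [indexVariance_eq, (sum_sum_offDiagonalSq m).2]
  push_cast
  ring

/-- The right-hand side of the even equation, at `m + 1`, in terms of Wallis ratios. -/
lemma even_rhs_eq (m : ℕ) : -(1 / (2 * Real.pi ^ 2))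
      * (Real.Gamma (((m + 1 : ℕ) : ℝ) + 1 / 2) * Real.Gamma (((m + 1 : ℕ) : ℝ) - 1 / 2)
        / Real.Gamma (((m + 1 : ℕ) : ℝ) + 1) ^ 2)
    = -(wallisRatio (m + 1) ^ 2 / (Real.pi * (2 * (m : ℝ) + 1))) := by
  have hs := Real.sq_sqrt Real.pi_pos.le
  have hpi := Real.pi_ne_zero
  have hf : (m.factorial : ℝ) ≠ 0 := by positivity
  have h1 : ((m + 1 : ℕ) : ℝ) - 1 / 2 = m + 1 / 2 := by push_cast; ring
  have hw : wallisRatio m = (2 * (m : ℝ) + 2) * wallisRatio (m + 1) / (2 * (m : ℝ) + 1) := by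
    rw [wallisRatio_succ_mul]
    field_simp
  rw [h1, Gamma_add_half_eq, Gamma_add_half_eq, Real.Gamma_nat_eq_factorial, hw,
    Nat.factorial_succ]
  push_cast
  field_simp
  rw [hs]

/-- The right-hand side of the odd equation in terms of Wallis ratios. -/
lemma odd_rhs_eq (m : ℕ) : -(1 / (2 * Real.pi ^ 2))
      * (Real.Gamma ((m : ℝ) + 1 / 2) ^ 2
        / (Real.Gamma ((m : ℝ) + 2) * Real.Gamma ((m : ℝ) + 1)))
    = -(wallisRatio m ^ 2 / (Real.pi * (2 * (m : ℝ) + 2))) := by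
  have hs := Real.sq_sqrt Real.pi_pos.le
  have hpi := Real.pi_ne_zero
  have hf : (m.factorial : ℝ) ≠ 0 := by positivity
  have h1 : (m : ℝ) + 2 = ((m + 1 : ℕ) : ℝ) + 1 := by push_cast; ring
  rw [h1, Gamma_add_half_eq, Real.Gamma_nat_eq_factorial, Real.Gamma_nat_eq_factorial,
    Nat.factorial_succ]
  push_cast
  field_simp
  rw [hs]

end GUE

/-- The second-order linear inhomogeneous difference equations for the even and for the odd terms
of the index variance. In the even equation at `m = 1`, the term `2m/(2m-2) * Δ_{2m-2}` is of the
form `2 * (0/0)`; there `Δ_{2m-2}/(2m-2)` is given its continued value `1/4`. -/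
theorem mainTheorem3 :
    (∀ m : ℕ, 2 ≤ m →
      (2 * (m : ℝ) + 1) / (2 * (m : ℝ) - 1) * GUE.indexVariance (2 * m + 2)
        - (1 + ((2 * (m : ℝ) + 2) * (2 * (m : ℝ) + 1)) / ((2 * (m : ℝ)) * (2 * (m : ℝ) - 1)))
          * GUE.indexVariance (2 * m)
        + (2 * (m : ℝ)) / (2 * (m : ℝ) - 2) * GUE.indexVariance (2 * m - 2)
      = -(1 / (2 * Real.pi ^ 2))
        * (Real.Gamma ((m : ℝ) + 1 / 2) * Real.Gamma ((m : ℝ) - 1 / 2)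
          / Real.Gamma ((m : ℝ) + 1) ^ 2)) ∧
    ((2 * (1 : ℝ) + 1) / (2 * (1 : ℝ) - 1) * GUE.indexVariance 4
        - (1 + ((2 * (1 : ℝ) + 2) * (2 * (1 : ℝ) + 1)) / ((2 * (1 : ℝ)) * (2 * (1 : ℝ) - 1)))
          * GUE.indexVariance 2
        + (2 * (1 : ℝ)) * (1 / 4)
      = -(1 / (2 * Real.pi ^ 2))
        * (Real.Gamma ((1 : ℝ) + 1 / 2) * Real.Gamma ((1 : ℝ) - 1 / 2)
          / Real.Gamma ((1 : ℝ) + 1) ^ 2)) ∧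
    (∀ m : ℕ, 1 ≤ m →
      (2 * (m : ℝ) + 1) / (2 * (m : ℝ) + 3) * GUE.indexVariance (2 * m + 3)
        - (1 + ((2 * (m : ℝ)) * (2 * (m : ℝ) - 1)) / ((2 * (m : ℝ) + 2) * (2 * (m : ℝ) + 1)))
          * GUE.indexVariance (2 * m + 1)
        + (2 * (m : ℝ)) / (2 * (m : ℝ) + 2) * GUE.indexVariance (2 * m - 1)
      = -(1 / (2 * Real.pi ^ 2))
        * (Real.Gamma ((m : ℝ) + 1 / 2) ^ 2
          / (Real.Gamma ((m : ℝ) + 2) * Real.Gamma ((m : ℝ) + 1)))) := by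
  have hpi := Real.pi_ne_zero
  have h14 : GUE.indexVariance 2 = 2 * (1 / 4 - GUE.varianceDefect 1 / Real.pi) := by
    simpa using GUE.indexVariance_even 1
  refine ⟨fun m hm => ?_, ?_, fun m hm => ?_⟩
  · obtain ⟨k, rfl⟩ : ∃ k, m = k + 1 := ⟨m - 1, by omega⟩
    have hk : (k : ℝ) ≠ 0 := by
      have : k ≠ 0 := by omega
      exact_mod_cast this
    rw [GUE.even_rhs_eq, show 2 * (k + 1) + 2 = 2 * (k + 2) by ring,
      show 2 * (k + 1) - 2 = 2 * k by omega, GUE.indexVariance_even, GUE.indexVariance_even,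
      GUE.indexVariance_even, ← GUE.varianceDefect_recurrence k]
    push_cast
    rw [show 2 * ((k : ℝ) + 1) - 1 = 2 * k + 1 by ring,
      show 2 * ((k : ℝ) + 1) - 2 = 2 * k by ring]
    field_simp
    ring
  · have h1 := GUE.even_rhs_eq 0
    have h2 := GUE.indexVariance_even 2
    have h3 := GUE.varianceDefect_recurrence 0
    norm_num at h1 h2 h3 ⊢
    rw [h1, h2, h14, ← h3, GUE.varianceDefect_zero]
    field_simp
    ring
  · obtain ⟨k, rfl⟩ : ∃ k, m = k + 1 := ⟨m - 1, by omega⟩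
    rw [GUE.odd_rhs_eq, show 2 * (k + 1) + 3 = 2 * (k + 2) + 1 by ring,
      show 2 * (k + 1) - 1 = 2 * k + 1 by omega, GUE.indexVariance_odd, GUE.indexVariance_odd,
      GUE.indexVariance_odd, ← GUE.varianceDefect_recurrence k]
    push_cast
    field_simp
    ring
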